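/- Let $k\ge 1$ and $n$ be integers and let $\mathbb{A}_1+b_1\subsetneq\cdots\subsetneq\mathbb{A}_k+b_k$ be a strictly increasing sequence of nested affine subspaces of $\mathbb{R}^n$ (an affine flag), with $d_j=\dim(\mathbb{A}_j+b_j)$ and $d_1\ge 1$. Let $\operatorname{Graff}(k,n)$ be the set of all $k$-dimensional affine subspaces of $\mathbb{R}^n$, regarded as a real affine algebraic variety in $\mathbb{R}^{n\times(n+1)}$ by identifying $\mathbb{B}+c$ with $[P,b]$, where $P$ is the matrix of the orthogonal projection onto the linear subspace $\mathbb{B}$ and $b$ is the point of $\mathbb{B}+c$ orthogonal to $\mathbb{B}$. Let \[ \Psi=\Psi(\mathbb{A}_1+b_1,\dots,\mathbb{A}_k+b_k)=\{\mathbb{B}+c\in\operatorname{Graff}(k,n):\dim\bigl((\mathbb{B}+c)\cap(\mathbb{A}_j+b_j)\bigr)\ge j,\ j=1,\dots,k\} \] be the corresponding affine Schubert variety, where an empty intersection has dimension less than every natural number. Then \[ \dim\Psi=\sum_{j=1}^k d_j-\frac{k(k+1)}{2}+(d_1-1), \] where $\dim\Psi$ is the Krull dimension of the coordinate ring $\mathbb{R}[x]/I(\Psi)$,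 $I(\Psi)$ being the ideal of all real polynomials in the entries of $[P,b]$ that vanish on $\Psi$ (equivalently, the dimension of the Zariski closure of $\Psi$). -/

import Mathlib

noncomputable section

/-- Dimension of an affine subspace of `ℝⁿ`: the dimension of its direction,
with value `⊥` (smaller than every natural number) for the empty one. -/
def affineDim {n : ℕ} (S : AffineSubspace ℝ (EuclideanSpace ℝ (Fin n))) : WithBot ℕ :=
  open Classical in if S = ⊥ then ⊥ else (Module.finrank ℝ S.direction : WithBot ℕ)

/-- The affine Grassmannian `Graff(k, n)`: the set of `k`-dimensional affine subspaces of `ℝⁿ`. -/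
def Graff (k n : ℕ) : Type :=
  {S : AffineSubspace ℝ (EuclideanSpace ℝ (Fin n)) // affineDim S = k}

theorem Graff.nonempty {k n : ℕ} (B : Graff k n) : Nonempty B.1 := by
  have h : B.1 ≠ ⊥ := by
    intro h0
    have hB := B.2
    simp [affineDim, h0] at hB
  exact ((AffineSubspace.nonempty_iff_ne_bot B.1).2 h).to_subtype

/-- The affine Schubert variety of `A₁ ⊆ ⋯ ⊆ A_k`: all `B ∈ Graff(k, n)` with
`dim (B ∩ A_j) ≥ j` for `j = 1, …, k`.  The index `j : Fin k` here stands for `j + 1`. -/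
def affineSchubert {k n : ℕ} (A : Fin k → AffineSubspace ℝ (EuclideanSpace ℝ (Fin n))) :
    Set (Graff k n) :=
  {B | ∀ j : Fin k, (((j : ℕ) + 1 : ℕ) : WithBot ℕ) ≤ affineDim (B.1 ⊓ A j)}

/-- Projection affine coordinates `[P, b] ∈ ℝ^{n × (n + 1)}` of a flat: `P` is the matrix of the
orthogonal projection onto its direction and `b` is its point orthogonal to the direction, i.e.
the foot of the perpendicular from the origin.  The entry `P i j` has index `Sum.inl (i, j)` and
the entry `b i` has index `Sum.inr i`.  This realizes `Graff(k, n)` as the real affine variety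
`{[P, b] : Pᵀ = P² = P, tr P = k, P b = 0}`. -/
def Graff.projCoord {k n : ℕ} (B : Graff k n) : (Fin n × Fin n) ⊕ Fin n → ℝ :=
  haveI := B.nonempty
  Sum.elim
    (fun p => B.1.direction.starProjection (EuclideanSpace.single p.2 (1 : ℝ)) p.1)
    (fun i => (EuclideanGeometry.orthogonalProjection B.1 0 : EuclideanSpace ℝ (Fin n)) i)

/-- Dimension of a subset `V` of a real affine space `ℝ^σ` in the sense of (real) algebraic
geometry: the Krull dimension of the coordinate ring `ℝ[x] / I(V)`, that is, the dimension of the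
Zariski closure of `V`. -/
def realVarietyDim {σ : Type} (V : Set (σ → ℝ)) : WithBot ℕ∞ :=
  ringKrullDim (MvPolynomial σ ℝ ⧸ MvPolynomial.vanishingIdeal ℝ V)

/-- Dimension of a subset of the affine Grassmannian, the latter being viewed as a real affine
variety through projection affine coordinates. -/
def Graff.varietyDim {k n : ℕ} (Ψ : Set (Graff k n)) : WithBot ℕ∞ :=
  realVarietyDim (Graff.projCoord '' Ψ)

end

/-!
The affine Schubert variety contains a Zariski dense subset that is birational to a real affine
space of the right dimension.

Write `V j` for the direction of the `j`-th member of the flag and fix a point `o` of its first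
member. Choose unit vectors `f j ∈ V j` orthogonal to all smaller `V i` (`exists_isAdaptedFrame`).
A flat `B` of the Schubert variety contains a point `p` of the first member, and its direction has a
basis `u` with `u j ∈ V j`. If `⟪f j, u j⟫ ≠ 0` for all `j`, triangular column operations replace
`u` by a basis `v` with `v j ∈ V j` and `⟪f i, v j⟫ = δ i j` (`IsAdaptedFrame.exists_isDualFamily`),
and `p` can be moved along `v` until `p - o` is orthogonal to all `f j`. So `B` is determined by the
vectors `v j - f j`, ranging over a space of dimension `d j - j` (with `j` starting at `1`), and by
`p - o`, ranging over a space of dimension `d 1 - 1`. These normalized flats form the slice, which is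
parametrized by a real vector space of dimension `∑ (d j - j) + (d 1 - 1)`. Every other flat of the
Schubert variety is a limit of flats in the slice, so the two sets have the same vanishing ideal
(`vanishingIdeal_affineSchubert`).

The coordinates `[P, b]` are regular rational functions of the slice parameters, as
`P = v G⁻¹ vᵀ` with `G` the Gram matrix of `v`. Conversely the vectors `v j` solve the linear system
`P (f l) = ∑ j, ⟪f j, P (f l)⟫ • v j`, whose determinant has no zero on the slice, and
`p - o = (b - o) - ∑ j, ⟪f j, b - o⟫ • v j`; so the parameters are rational functions of `[P, b]`
(`aeval_vecPoly`, `aeval_shiftPoly`). Hence the coordinate ring is a domain whose fraction field is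
the field of rational functions in the parameters, and its Krull dimension, being its transcendence
degree (`ringKrullDim_eq_trdeg`), is the number of parameters (`realVarietyDim_range`).
-/

/-! ### Krull dimension and transcendence degree -/

theorem ringKrullDim_eq_of_isIntegral (R S : Type*) [CommRing R] [CommRing S] [Algebra R S]
    [Algebra.IsIntegral R S] (hinj : Function.Injective (algebraMap R S)) :
    ringKrullDim S = ringKrullDim R := by
  apply le_antisymm
  · refine Order.krullDim_le_of_strictMono (PrimeSpectrum.comap (algebraMap R S)) ?_
    intro p q hpq
    exact Ideal.IsIntegral.comap_lt_comap (A := S) (R := R) hpq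
  · refine iSup_le fun l => ?_
    obtain ⟨P, -, _, hP⟩ := Ideal.exists_ideal_over_prime_of_isIntegral (S := S)
      l.head.asIdeal ⊥ (by
        rw [← RingHom.ker_eq_comap_bot, (RingHom.injective_iff_ker_eq_bot _).1 hinj]
        exact bot_le)
    have : P.LiesOver l.head.asIdeal := ⟨hP.symm⟩
    obtain ⟨L, hL, -⟩ := Ideal.exists_ltSeries_of_hasGoingUp (S := S) l P
    rw [← hL]
    exact Order.LTSeries.length_le_krullDim L

/-- The Krull dimension of a finitely generated domain over a field is its transcendence degree:
Noether normalization reduces this to polynomial rings. -/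
theorem ringKrullDim_eq_trdeg {k R : Type} [Field k] [CommRing R] [IsDomain R] [Algebra k R]
    [Algebra.FiniteType k R] {m : ℕ} (hm : Algebra.trdeg k R = m) :
    ringKrullDim R = ((m : ℕ∞) : WithBot ℕ∞) := by
  obtain ⟨s, g, hg, hint⟩ := exists_integral_inj_algHom_of_fg k R
  algebraize [g.toRingHom]
  have : IsScalarTower k (MvPolynomial (Fin s) k) R :=
    IsScalarTower.of_algebraMap_eq fun x => (g.commutes x).symm
  have hint' : Algebra.IsIntegral (MvPolynomial (Fin s) k) R := ⟨hint⟩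
  rw [ringKrullDim_eq_of_isIntegral (MvPolynomial (Fin s) k) R hg,
    MvPolynomial.ringKrullDim_of_isNoetherianRing, ringKrullDim_eq_zero_of_field]
  have : FaithfulSMul (MvPolynomial (Fin s) k) R :=
    (faithfulSMul_iff_algebraMap_injective _ _).2 hg
  have := (IsTranscendenceBasis.mvPolynomial (Fin s) k).algebraMap_comp (A := R)
  have h := this.cardinalMk_eq_trdeg
  rw [hm] at h
  have : s = m := by simpa using h
  subst this
  simp

/-! ### Regular functions on `ℝ^ι` and sets with a birational parametrization -/

section
variable {ι : Type} {σ : Type}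
open MvPolynomial

/-- The functions `ℝ^ι → ℝ` that are quotients of two polynomials with nowhere vanishing
denominator. -/
def regularFunctions (ι : Type) : Subalgebra ℝ ((ι → ℝ) → ℝ) where
  carrier := {u | ∃ N D : MvPolynomial ι ℝ, ∀ t, eval t D ≠ 0 ∧ u t * eval t D = eval t N}
  mul_mem' := by
    rintro u v ⟨N, D, h⟩ ⟨N', D', h'⟩
    refine ⟨N * N', D * D', fun t => ⟨?_, ?_⟩⟩
    · simpa using ⟨(h t).1, (h' t).1⟩
    · simp only [Pi.mul_apply, map_mul, ← (h t).2, ← (h' t).2]; ring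
  add_mem' := by
    rintro u v ⟨N, D, h⟩ ⟨N', D', h'⟩
    refine ⟨N * D' + N' * D, D * D', fun t => ⟨?_, ?_⟩⟩
    · simpa using ⟨(h t).1, (h' t).1⟩
    · simp only [Pi.add_apply, map_mul, map_add, ← (h t).2, ← (h' t).2]; ring
  algebraMap_mem' r := ⟨C r, 1, fun t => by simp⟩

theorem const_mem_regularFunctions (r : ℝ) : (fun _ => r) ∈ regularFunctions ι :=
  (regularFunctions ι).algebraMap_mem r

theorem coord_mem_regularFunctions (i : ι) : (fun t => t i) ∈ regularFunctions ι :=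
  ⟨X i, 1, fun t => by simp⟩

theorem inv_mem_regularFunctions {u : (ι → ℝ) → ℝ} (hu : u ∈ regularFunctions ι)
    (h0 : ∀ t, u t ≠ 0) : (fun t => (u t)⁻¹) ∈ regularFunctions ι := by
  obtain ⟨N, D, h⟩ := hu
  refine ⟨D, N, fun t => ⟨?_, ?_⟩⟩
  · rw [← (h t).2]; exact mul_ne_zero (h0 t) (h t).1
  · rw [← (h t).2, inv_mul_cancel_left₀ (h0 t)]

theorem det_mem_regularFunctions {κ : Type} [Fintype κ] [DecidableEq κ]
    {M : (ι → ℝ) → Matrix κ κ ℝ} (hM : ∀ i j, (fun t => M t i j) ∈ regularFunctions ι) :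
    (fun t => (M t).det) ∈ regularFunctions ι := by
  have : (fun t => (M t).det) =
      (Matrix.det (Matrix.of fun i j => (⟨_, hM i j⟩ : regularFunctions ι))).1 := by
    funext t
    exact (((Pi.evalRingHom (fun _ => ℝ) t).comp (regularFunctions ι).val.toRingHom).map_det
      (Matrix.of fun i j => (⟨_, hM i j⟩ : regularFunctions ι))).symm
  rw [this]
  exact Subtype.property _

theorem matrixInv_mem_regularFunctions {κ : Type} [Fintype κ] [DecidableEq κ]
    {M : (ι → ℝ) → Matrix κ κ ℝ} (hM : ∀ i j, (fun t => M t i j) ∈ regularFunctions ι)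
    (h0 : ∀ t, (M t).det ≠ 0) (i j : κ) :
    (fun t => (M t)⁻¹ i j) ∈ regularFunctions ι := by
  have : (fun t => (M t)⁻¹ i j) =
      (fun t => (M t).det⁻¹) * fun t => ((M t).updateRow j (Pi.single i 1)).det := by
    funext t
    simp [Matrix.inv_def, Matrix.adjugate_apply]
  rw [this]
  refine mul_mem (inv_mem_regularFunctions (det_mem_regularFunctions hM) h0)
    (det_mem_regularFunctions fun a b => ?_)
  by_cases h : a = j
  · subst h
    simpa using const_mem_regularFunctions _
  · simpa [h] using hM a b

/-- The vanishing ideal of the image of a rational map `φ = N / D` that is defined everywhere is the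
kernel of the substitution of `N / D` in the field of rational functions. -/
theorem vanishingIdeal_eq_ker {K : Type} [Field K] [Algebra ℝ K]
    [Algebra (MvPolynomial ι ℝ) K] [IsScalarTower ℝ (MvPolynomial ι ℝ) K]
    [IsFractionRing (MvPolynomial ι ℝ) K]
    {φ : (ι → ℝ) → σ → ℝ} {N D : σ → MvPolynomial ι ℝ}
    (h : ∀ s t, eval t (D s) ≠ 0 ∧ φ t s * eval t (D s) = eval t (N s)) :
    vanishingIdeal ℝ (Set.range φ) =
      RingHom.ker (aeval (R := ℝ) fun s => algebraMap (MvPolynomial ι ℝ) K (N s) /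
        algebraMap (MvPolynomial ι ℝ) K (D s)) := by
  have inj := IsFractionRing.injective (MvPolynomial ι ℝ) K
  -- every polynomial has a common denominator after substitution, both as a function and formally
  have key : ∀ f : MvPolynomial σ ℝ, ∃ N' D' : MvPolynomial ι ℝ,
      (∀ t, eval t D' ≠ 0 ∧ aeval (φ t) f * eval t D' = eval t N') ∧
      aeval (R := ℝ) (fun s => algebraMap (MvPolynomial ι ℝ) K (N s) /
        algebraMap (MvPolynomial ι ℝ) K (D s)) f * algebraMap _ K D' = algebraMap _ K N' := by
    intro f
    induction f using MvPolynomial.induction_on with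
    | C a =>
      refine ⟨C a, 1, fun t => by simp, ?_⟩
      simp [IsScalarTower.algebraMap_apply ℝ (MvPolynomial ι ℝ) K, MvPolynomial.algebraMap_eq]
    | add p q hp hq =>
      obtain ⟨N₁, D₁, h₁, e₁⟩ := hp
      obtain ⟨N₂, D₂, h₂, e₂⟩ := hq
      refine ⟨N₁ * D₂ + N₂ * D₁, D₁ * D₂, fun t => ⟨?_, ?_⟩, ?_⟩
      · simpa using ⟨(h₁ t).1, (h₂ t).1⟩
      · simp only [map_mul, map_add, ← (h₁ t).2, ← (h₂ t).2]; ring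
      · simp only [map_mul, map_add, ← e₁, ← e₂]; ring
    | mul_X p s hp =>
      obtain ⟨N₁, D₁, h₁, e₁⟩ := hp
      refine ⟨N₁ * N s, D₁ * D s, fun t => ⟨?_, ?_⟩, ?_⟩
      · simpa using ⟨(h₁ t).1, (h s t).1⟩
      · simp only [map_mul, aeval_X, ← (h₁ t).2, ← (h s t).2]; ring
      · have : algebraMap (MvPolynomial ι ℝ) K (D s) ≠ 0 := by
          rw [map_ne_zero_iff _ inj]
          intro h0
          exact (h s 0).1 (by simp [h0])
        simp only [map_mul, aeval_X, ← e₁]; field_simp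
  ext f
  obtain ⟨N', D', h', e⟩ := key f
  have hD : algebraMap (MvPolynomial ι ℝ) K D' ≠ 0 := by
    rw [map_ne_zero_iff _ inj]
    intro h0
    exact (h' 0).1 (by simp [h0])
  rw [RingHom.mem_ker, ← mul_eq_zero_iff_right hD, e, map_eq_zero_iff _ inj,
    mem_vanishingIdeal_iff, Set.forall_mem_range]
  constructor
  · intro hf
    refine MvPolynomial.funext fun t => ?_
    rw [← (h' t).2, hf, zero_mul, map_zero]
  · rintro rfl t
    have := (h' t).2
    rw [map_zero] at this
    exact (mul_eq_zero.1 this).resolve_right (h' t).1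

/-- A finitely generated domain has dimension `|ι|` if it embeds into the field of rational functions
in variables indexed by `ι` so that each variable is a quotient of two of its elements: the field is
then algebraic over the domain. -/
theorem ringKrullDim_eq_card_of_birational [Fintype ι] {k A K : Type} [Field k] [CommRing A]
    [IsDomain A] [Algebra k A] [Algebra.FiniteType k A] [Field K]
    [Algebra k K] [Algebra (MvPolynomial ι k) K] [IsScalarTower k (MvPolynomial ι k) K]
    [IsFractionRing (MvPolynomial ι k) K] (g : A →ₐ[k] K) (hg : Function.Injective g)
    (hrat : ∀ i, ∃ p q : A, g q ≠ 0 ∧ algebraMap (MvPolynomial ι k) K (X i) * g q = g p) :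
    ringKrullDim A = ((Fintype.card ι : ℕ∞) : WithBot ℕ∞) := by
  apply ringKrullDim_eq_trdeg (k := k)
  algebraize [g.toRingHom]
  have : IsScalarTower k A K := IsScalarTower.of_algebraMap_eq fun x => (g.commutes x).symm
  have : FaithfulSMul A K := (faithfulSMul_iff_algebraMap_injective _ _).2 hg
  have hX : ∀ i, IsAlgebraic A (algebraMap (MvPolynomial ι k) K (X i)) := by
    intro i
    obtain ⟨p, q, hq, hpq⟩ := hrat i
    rw [eq_div_of_mul_eq hq hpq, div_eq_mul_inv]
    exact (isAlgebraic_algebraMap p).mul (isAlgebraic_algebraMap q).inv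
  have hpoly : ∀ p : MvPolynomial ι k, IsAlgebraic A
      (algebraMap (MvPolynomial ι k) K p) := by
    intro p
    induction p using MvPolynomial.induction_on with
    | C a =>
      have : algebraMap (MvPolynomial ι k) K (C a) =
          algebraMap A K (algebraMap k _ a) := by
        rw [← IsScalarTower.algebraMap_apply, ← MvPolynomial.algebraMap_eq,
          ← IsScalarTower.algebraMap_apply]
      rw [this]
      exact isAlgebraic_algebraMap _
    | add p q hp hq => rw [map_add]; exact hp.add hq
    | mul_X p i hp => rw [map_mul]; exact hp.mul (hX i)
  have halg : Algebra.IsAlgebraic A K := by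
    refine ⟨fun z => ?_⟩
    obtain ⟨a, b, -, rfl⟩ := IsFractionRing.div_surjective (A := MvPolynomial ι k) z
    rw [div_eq_mul_inv]
    exact (hpoly a).mul (hpoly b).inv
  obtain ⟨s, hs⟩ := exists_isTranscendenceBasis k A
  have h1 := (hs.algebraMap_comp (A := K)).cardinalMk_eq_trdeg
  have : FaithfulSMul (MvPolynomial ι k) K :=
    (faithfulSMul_iff_algebraMap_injective _ _).2 (IsFractionRing.injective _ K)
  have : Algebra.IsAlgebraic (MvPolynomial ι k) K :=
    IsLocalization.isAlgebraic K (nonZeroDivisors (MvPolynomial ι k))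
  have h2 := ((IsTranscendenceBasis.mvPolynomial ι k).algebraMap_comp (A := K)).cardinalMk_eq_trdeg
  rw [← hs.cardinalMk_eq_trdeg, h1, ← h2, Cardinal.mk_fintype]

/-- If `φ` is a regular map on `ℝ^ι` and the parameters `t i` are rational functions of `φ t`, then
the image of `φ` has dimension `|ι|`. -/
theorem realVarietyDim_range [Fintype ι] [Finite σ] {φ : (ι → ℝ) → σ → ℝ}
    (hφ : ∀ s, (fun t => φ t s) ∈ regularFunctions ι)
    (hinv : ∀ i, ∃ p q : MvPolynomial σ ℝ, ∀ t, aeval (φ t) q ≠ 0 ∧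
      t i * aeval (φ t) q = aeval (φ t) p) :
    realVarietyDim (Set.range φ) = ((Fintype.card ι : ℕ∞) : WithBot ℕ∞) := by
  choose N D h using hφ
  let K := FractionRing (MvPolynomial ι ℝ)
  let F : MvPolynomial σ ℝ →ₐ[ℝ] K := aeval fun s => algebraMap (MvPolynomial ι ℝ) K (N s) /
        algebraMap (MvPolynomial ι ℝ) K (D s)
  have hker : vanishingIdeal ℝ (Set.range φ) = RingHom.ker F := vanishingIdeal_eq_ker h
  have hrat : ∀ i, ∃ p q : MvPolynomial σ ℝ, F q ≠ 0 ∧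
      algebraMap (MvPolynomial ι ℝ) K (X i) * F q = F p := by
    intro i
    obtain ⟨p, q, hpq⟩ := hinv i
    refine ⟨p, q, ?_, ?_⟩
    · rw [Ne, ← RingHom.mem_ker, ← hker]
      exact fun hq => (hpq 0).1 (hq _ ⟨0, rfl⟩)
    -- the relation holds on the graph `{(φ t, t)}`, which is parametrized by rational functions too
    have hgraph := vanishingIdeal_eq_ker (K := K) (φ := fun t => Sum.elim (φ t) t)
      (N := Sum.elim N X) (D := Sum.elim D 1) (by rintro (s | i) t <;> simp [h])
    have hmem : X (Sum.inr i) * rename Sum.inl q - rename Sum.inl p ∈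
        vanishingIdeal ℝ (Set.range fun t : ι → ℝ => Sum.elim (φ t) t) := by
      rintro _ ⟨t, rfl⟩
      rw [map_sub, map_mul, aeval_rename, aeval_rename, aeval_X]
      exact sub_eq_zero.2 (hpq t).2
    rw [hgraph, RingHom.mem_ker, map_sub, map_mul, aeval_rename, aeval_rename, aeval_X,
      sub_eq_zero] at hmem
    simpa [F, Function.comp_def] using hmem
  rw [realVarietyDim, hker]
  have hprime : (RingHom.ker F).IsPrime := RingHom.ker_isPrime _
  exact ringKrullDim_eq_card_of_birational (k := ℝ) (Ideal.kerLiftAlg F)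
    (Ideal.kerLiftAlg_injective F) fun i => by
      obtain ⟨p, q, h⟩ := hrat i
      exact ⟨Ideal.Quotient.mk _ p, Ideal.Quotient.mk _ q, h⟩

end

/-! ### Orthogonal projections and projection coordinates of flats -/

section
open Matrix Submodule

/-- The expression `v G⁻¹ vᵀ w`, with `G` the Gram matrix of the vectors `v i`. It is the orthogonal
projection of `w` to their span if they are linearly independent. -/
noncomputable def gramProj {n k : ℕ} (v : Fin k → EuclideanSpace ℝ (Fin n))
    (w : EuclideanSpace ℝ (Fin n)) : EuclideanSpace ℝ (Fin n) :=
  ∑ i, ∑ j, ((gram ℝ v)⁻¹ i j * inner ℝ (v j) w) • v i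

variable {n k : ℕ}

theorem starProjection_span_range_eq_gramProj {v : Fin k → EuclideanSpace ℝ (Fin n)}
    (hv : LinearIndependent ℝ v) (w : EuclideanSpace ℝ (Fin n)) :
    (span ℝ (Set.range v)).starProjection w = gramProj v w := by
  have hdet : IsUnit (gram ℝ v).det := (det_gram_ne_zero_iff_linearIndependent.2 hv).isUnit
  refine eq_starProjection_of_mem_orthogonal ?_ ?_
  · exact sum_mem fun i _ => sum_mem fun j _ =>
      smul_mem _ _ (subset_span (Set.mem_range_self i))
  · rw [mem_orthogonal]
    have key : ∀ l, inner ℝ (v l) (gramProj v w) = inner ℝ (v l) w := by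
      intro l
      calc inner ℝ (v l) (gramProj v w)
          = ∑ j, (∑ i, gram ℝ v l i * (gram ℝ v)⁻¹ i j) * inner ℝ (v j) w := by
            simp only [gramProj, inner_sum, inner_smul_right, gram_apply, Finset.sum_mul]
            rw [Finset.sum_comm]
            refine Finset.sum_congr rfl fun j _ => Finset.sum_congr rfl fun i _ => by ring
        _ = inner ℝ (v l) w := by
            simp_rw [← Matrix.mul_apply, Matrix.mul_nonsing_inv _ hdet, Matrix.one_apply]
            simp
    intro u hu
    induction hu using span_induction with
    | mem x hx =>
      obtain ⟨l, rfl⟩ := hx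
      rw [inner_sub_right, key, sub_self]
    | zero => simp
    | add x y _ _ hx hy => rw [inner_add_left, hx, hy, add_zero]
    | smul a x _ hx => rw [inner_smul_left, hx, mul_zero]

theorem continuousAt_gramProj {T : Type*} [TopologicalSpace T]
    {v : T → Fin k → EuclideanSpace ℝ (Fin n)} {t : T} (hc : Continuous v)
    (hv : LinearIndependent ℝ (v t)) (w : EuclideanSpace ℝ (Fin n)) :
    ContinuousAt (fun s => gramProj (v s) w) t := by
  have hG : Continuous fun s => gram ℝ (v s) :=
    continuous_matrix fun i j => by simp only [gram_apply]; fun_prop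
  have hdet : (gram ℝ (v t)).det ≠ 0 := det_gram_ne_zero_iff_linearIndependent.2 hv
  have hinv : ContinuousAt (fun s => (gram ℝ (v s))⁻¹) t := by
    simp only [Matrix.inv_def, Ring.inverse_eq_inv']
    exact (hG.matrix_det.continuousAt.inv₀ hdet).smul hG.matrix_adjugate.continuousAt
  have hinv' : ∀ i j, ContinuousAt (fun s => (gram ℝ (v s))⁻¹ i j) t := fun i j =>
    (continuous_id.matrix_elem i j).continuousAt.comp hinv
  have hvc : ∀ i, ContinuousAt (fun s => v s i) t := fun i =>
    ((continuous_apply i).comp hc).continuousAt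
  unfold gramProj
  refine tendsto_finsetSum _ fun i _ => tendsto_finsetSum _ fun j _ => ?_
  exact ((hinv' i j).mul ((hvc j).inner continuousAt_const)).smul (hvc i)

theorem inner_mem_regularFunctions {ι : Type} {x y : (ι → ℝ) → EuclideanSpace ℝ (Fin n)}
    (hx : ∀ a, (fun t => x t a) ∈ regularFunctions ι)
    (hy : ∀ a, (fun t => y t a) ∈ regularFunctions ι) :
    (fun t => inner ℝ (x t) (y t)) ∈ regularFunctions ι := by
  have : (fun t => inner ℝ (x t) (y t)) = ∑ a, (fun t => y t a) * (fun t => x t a) := by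
    funext t
    simp [PiLp.inner_apply]
  rw [this]
  exact sum_mem fun a _ => mul_mem (hy a) (hx a)

theorem gramProj_mem_regularFunctions {ι : Type} {v : (ι → ℝ) → Fin k → EuclideanSpace ℝ (Fin n)}
    {w : (ι → ℝ) → EuclideanSpace ℝ (Fin n)} (hli : ∀ t, LinearIndependent ℝ (v t))
    (hv : ∀ i a, (fun t => v t i a) ∈ regularFunctions ι)
    (hw : ∀ a, (fun t => w t a) ∈ regularFunctions ι) (a : Fin n) :
    (fun t => gramProj (v t) (w t) a) ∈ regularFunctions ι := by
  have : (fun t => gramProj (v t) (w t) a) = ∑ i, ∑ j,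
      (fun t => (gram ℝ (v t))⁻¹ i j) * (fun t => inner ℝ (v t j) (w t)) * fun t => v t i a := by
    funext t
    simp [gramProj]
  rw [this]
  refine sum_mem fun i _ => sum_mem fun j _ => mul_mem (mul_mem ?_ ?_) (hv i a)
  · exact matrixInv_mem_regularFunctions
      (fun a b => inner_mem_regularFunctions (hv a) (hv b))
      (fun t => det_gram_ne_zero_iff_linearIndependent.2 (hli t)) i j
  · exact inner_mem_regularFunctions (hv j) hw

/-- The projection coordinates `[P, p - P p]` of the flat `p + span v`, where `P` is given by
`gramProj`; meaningful for linearly independent `v`. -/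
noncomputable def flatCoord (v : Fin k → EuclideanSpace ℝ (Fin n)) (p : EuclideanSpace ℝ (Fin n)) :
    (Fin n × Fin n) ⊕ Fin n → ℝ :=
  Sum.elim (fun q => gramProj v (EuclideanSpace.single q.2 1) q.1) (fun a => (p - gramProj v p) a)

theorem Graff.projCoord_eq_flatCoord (B : Graff k n) {v : Fin k → EuclideanSpace ℝ (Fin n)}
    (hv : LinearIndependent ℝ v) (hdir : B.1.direction = span ℝ (Set.range v))
    {p : EuclideanSpace ℝ (Fin n)} (hp : p ∈ B.1) : B.projCoord = flatCoord v p := by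
  funext s
  have : Nonempty B.1 := B.nonempty
  rcases s with ⟨a, b⟩ | a
  · simp only [Graff.projCoord, flatCoord, Sum.elim_inl, hdir,
      starProjection_span_range_eq_gramProj hv]
  · simp only [Graff.projCoord, flatCoord, Sum.elim_inr]
    rw [EuclideanGeometry.orthogonalProjection_apply_mem _ hp,
      ← starProjection_span_range_eq_gramProj hv, ← hdir]
    simp only [vsub_eq_sub, zero_sub, map_neg, vadd_eq_add, Submodule.coe_neg, neg_add_eq_sub,
      Submodule.coe_orthogonalProjectionOnto_apply]

theorem affineDim_eq_finrank_direction {S : AffineSubspace ℝ (EuclideanSpace ℝ (Fin n))}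
    {p : EuclideanSpace ℝ (Fin n)} (hp : p ∈ S) :
    affineDim S = Module.finrank ℝ S.direction := by
  have : S ≠ ⊥ := by rintro rfl; exact hp
  simp [affineDim, this]

/-- The `k`-flat through `p` with direction spanned by the linearly independent vectors `v`. -/
noncomputable def Graff.ofSpan (p : EuclideanSpace ℝ (Fin n)) (v : Fin k → EuclideanSpace ℝ (Fin n))
    (hv : LinearIndependent ℝ v) : Graff k n :=
  ⟨AffineSubspace.mk' p (span ℝ (Set.range v)), by
    rw [affineDim_eq_finrank_direction (AffineSubspace.self_mem_mk' p _),
      AffineSubspace.direction_mk', finrank_span_eq_card hv, Fintype.card_fin]⟩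

theorem Graff.mem_ofSpan (p : EuclideanSpace ℝ (Fin n)) {v : Fin k → EuclideanSpace ℝ (Fin n)}
    (hv : LinearIndependent ℝ v) : p ∈ (Graff.ofSpan p v hv).1 :=
  AffineSubspace.self_mem_mk' p _

theorem Graff.direction_ofSpan (p : EuclideanSpace ℝ (Fin n))
    {v : Fin k → EuclideanSpace ℝ (Fin n)} (hv : LinearIndependent ℝ v) :
    (Graff.ofSpan p v hv).1.direction = span ℝ (Set.range v) :=
  AffineSubspace.direction_mk' p _

theorem Graff.projCoord_ofSpan (p : EuclideanSpace ℝ (Fin n))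
    {v : Fin k → EuclideanSpace ℝ (Fin n)} (hv : LinearIndependent ℝ v) :
    (Graff.ofSpan p v hv).projCoord = flatCoord v p :=
  Graff.projCoord_eq_flatCoord (Graff.ofSpan p v hv) hv (Graff.direction_ofSpan p hv)
    (Graff.mem_ofSpan p hv)

/-- Once `B` meets the smallest member of the flag, the Schubert conditions are linear conditions on
the direction of `B`. -/
theorem mem_affineSchubert_iff_finrank {A : Fin k → AffineSubspace ℝ (EuclideanSpace ℝ (Fin n))}
    (hA : Monotone A) (hk : 0 < k) {B : Graff k n} :
    B ∈ affineSchubert A ↔ ∃ p ∈ B.1, p ∈ A ⟨0, hk⟩ ∧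
      ∀ j : Fin k, (j : ℕ) + 1 ≤ Module.finrank ℝ ↥(B.1.direction ⊓ (A j).direction) := by
  have key : ∀ p ∈ B.1, p ∈ A ⟨0, hk⟩ → ∀ j, affineDim (B.1 ⊓ A j) =
      Module.finrank ℝ ↥(B.1.direction ⊓ (A j).direction) := by
    intro p hpB hpA j
    have hpj : p ∈ A j := hA (show (⟨0, hk⟩ : Fin k) ≤ j from Nat.zero_le _) hpA
    rw [affineDim_eq_finrank_direction (AffineSubspace.mem_inf_iff _ _ _ |>.2 ⟨hpB, hpj⟩),
      AffineSubspace.direction_inf_of_mem hpB hpj]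
  constructor
  · intro hB
    have h0 : _ ≤ affineDim (B.1 ⊓ A ⟨0, hk⟩) := hB ⟨0, hk⟩
    have hne : B.1 ⊓ A ⟨0, hk⟩ ≠ ⊥ := by
      intro h
      rw [h] at h0
      simp [affineDim] at h0
    obtain ⟨p, hpB, hpA⟩ := (AffineSubspace.nonempty_iff_ne_bot _).2 hne
    refine ⟨p, hpB, hpA, fun j => ?_⟩
    have hj : _ ≤ affineDim (B.1 ⊓ A j) := hB j
    rw [key p hpB hpA j] at hj
    exact_mod_cast hj
  · rintro ⟨p, hpB, hpA, h⟩ j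
    rw [key p hpB hpA j]
    exact_mod_cast h j

end

/-! ### Frames adapted to a flag of subspaces -/

section
open Matrix Submodule

variable {k : ℕ}

/-- A greedy choice of linearly independent vectors `u j ∈ U j`. -/
theorem exists_linearIndependent_mem {K E : Type*} [Field K] [AddCommGroup E] [Module K E]
    {U : Fin k → Submodule K E} [FiniteDimensional K E]
    (hU : ∀ j : Fin k, (j : ℕ) + 1 ≤ Module.finrank K (U j)) :
    ∃ u : Fin k → E, LinearIndependent K u ∧ ∀ j, u j ∈ U j := by
  induction k with
  | zero => exact ⟨Fin.elim0, linearIndependent_empty_type, fun j => j.elim0⟩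
  | succ k ih =>
    obtain ⟨u, hu, huU⟩ := ih (U := fun j => U j.castSucc) fun j => hU j.castSucc
    obtain ⟨x, hxU, hx⟩ : ∃ x ∈ U (Fin.last k), x ∉ span K (Set.range u) := by
      by_contra! h
      have h1 := Submodule.finrank_mono (show U (Fin.last k) ≤ span K (Set.range u) from h)
      have h2 := hU (Fin.last k)
      rw [finrank_span_eq_card hu, Fintype.card_fin] at h1
      simp at h2
      omega
    refine ⟨Fin.snoc u x, linearIndependent_finSnoc.2 ⟨hu, hx⟩, fun j => ?_⟩
    induction j using Fin.lastCases with
    | last => simpa using hxU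
    | cast j => simpa using huU j

variable {E : Type*} [NormedAddCommGroup E] [InnerProductSpace ℝ E]

/-- Unit vectors `f j ∈ V j` such that `f j` is orthogonal to `V i` for all `i < j`. -/
structure IsAdaptedFrame (V : Fin k → Submodule ℝ E) (f : Fin k → E) : Prop where
  mem : ∀ j, f j ∈ V j
  inner_self : ∀ j, inner ℝ (f j) (f j) = 1
  inner_eq_zero : ∀ i j, i < j → ∀ x ∈ V i, inner ℝ (f j) x = 0

theorem exists_isAdaptedFrame [FiniteDimensional ℝ E] {V : Fin k → Submodule ℝ E}
    (hV : StrictMono V) (hV0 : ∀ j, V j ≠ ⊥) : ∃ f, IsAdaptedFrame V f := by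
  have key : ∀ j, ∃ x ∈ V j, inner ℝ x x = 1 ∧ ∀ i < j, ∀ y ∈ V i, inner ℝ x y = 0 := by
    intro j
    obtain ⟨U, hUj, hU⟩ : ∃ U < V j, ∀ i < j, V i ≤ U := by
      by_cases hj : (j : ℕ) = 0
      · exact ⟨⊥, bot_lt_iff_ne_bot.2 (hV0 j), fun i hi => by
          rw [Fin.lt_def] at hi; omega⟩
      · refine ⟨V ⟨j - 1, by omega⟩, hV ?_, fun i hi => hV.monotone ?_⟩
        · rw [Fin.lt_def]; simp only; omega
        · rw [Fin.lt_def] at hi; rw [Fin.le_def]; simp only; omega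
    obtain ⟨y, hyV, hyU⟩ := SetLike.exists_of_lt hUj
    set z := y - U.starProjection y with hz
    have hz0 : z ≠ 0 := by
      intro h
      exact hyU ((sub_eq_zero.1 h) ▸ U.starProjection_apply_mem y)
    have hzV : z ∈ V j := sub_mem hyV (hUj.le (U.starProjection_apply_mem y))
    have hzU : z ∈ Uᗮ := sub_starProjection_mem_orthogonal y
    refine ⟨‖z‖⁻¹ • z, smul_mem _ _ hzV, ?_, fun i hi x hx => ?_⟩
    · have := norm_ne_zero_iff.2 hz0
      rw [real_inner_smul_left, real_inner_smul_right, real_inner_self_eq_norm_sq]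
      field_simp
    · rw [real_inner_smul_left, inner_left_of_mem_orthogonal (hU i hi hx) hzU, mul_zero]
  choose f hf1 hf2 hf3 using key
  exact ⟨f, hf1, hf2, fun i j hij x hx => hf3 j i hij x hx⟩

/-- `⟪f i, v j⟫ = δ i j` for all `i` and `j`. -/
def IsDualFamily (f v : Fin k → E) : Prop :=
  ∀ i j, inner ℝ (f i) (v j) = if i = j then 1 else 0

theorem IsDualFamily.eq_sum_smul {f v : Fin k → E} (h : IsDualFamily f v) {x : E}
    (hx : x ∈ span ℝ (Set.range v)) : x = ∑ j, inner ℝ (f j) x • v j := by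
  obtain ⟨c, rfl⟩ := (mem_span_range_iff_exists_fun ℝ).1 hx
  refine Finset.sum_congr rfl fun j _ => ?_
  simp [inner_sum, inner_smul_right, h j]

theorem IsDualFamily.linearIndependent {f v : Fin k → E} (h : IsDualFamily f v) :
    LinearIndependent ℝ v := by
  rw [Fintype.linearIndependent_iff]
  intro c hc i
  have : inner ℝ (f i) (∑ j, c j • v j) = 0 := by rw [hc, inner_zero_right]
  simpa [inner_sum, inner_smul_right, h i] using this

variable {V : Fin k → Submodule ℝ E} {f : Fin k → E}

theorem IsAdaptedFrame.isDualFamily_self (h : IsAdaptedFrame V f) : IsDualFamily f f := by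
  intro i j
  rcases lt_trichotomy i j with hij | rfl | hij
  · rw [real_inner_comm, h.inner_eq_zero i j hij _ (h.mem i), if_neg hij.ne]
  · rw [h.inner_self, if_pos rfl]
  · rw [h.inner_eq_zero j i hij _ (h.mem j), if_neg hij.ne']

/-- Vectors `u j ∈ V j` with `⟪f j, u j⟫ ≠ 0` can be normalized to a family dual to the frame, without
changing their span: the matrix `⟪f i, u j⟫` is upper triangular, hence so is its inverse. -/
theorem IsAdaptedFrame.exists_isDualFamily (h : IsAdaptedFrame V f) (hV : Monotone V)
    {u : Fin k → E} (hu : ∀ j, u j ∈ V j) (hne : ∀ j, inner ℝ (f j) (u j) ≠ 0) :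
    ∃ v, (∀ j, v j ∈ V j) ∧ IsDualFamily f v ∧ span ℝ (Set.range v) = span ℝ (Set.range u) := by
  let M : Matrix (Fin k) (Fin k) ℝ := of fun i j => inner ℝ (f i) (u j)
  have hM : M.IsUpperTriangular := fun i j hij => h.inner_eq_zero j i hij _ (hu j)
  have hdet : IsUnit M.det := by
    rw [det_of_isUpperTriangular hM, isUnit_iff_ne_zero]
    exact Finset.prod_ne_zero_iff.2 fun j _ => hne j
  have : Invertible M := M.invertibleOfIsUnitDet hdet
  have hMinv : M⁻¹.IsUpperTriangular := blockTriangular_inv_of_blockTriangular hM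
  have hdual : IsDualFamily f fun j => ∑ i, M⁻¹ i j • u i := by
    intro l j
    have : inner ℝ (f l) (∑ i, M⁻¹ i j • u i) = (M * M⁻¹) l j := by
      simp only [inner_sum, inner_smul_right, Matrix.mul_apply, M, of_apply]
      exact Finset.sum_congr rfl fun i _ => mul_comm _ _
    rw [this, mul_nonsing_inv _ hdet, Matrix.one_apply]
  refine ⟨fun j => ∑ i, M⁻¹ i j • u i, fun j => sum_mem fun i _ => ?_, hdual, ?_⟩
  · rcases le_or_gt i j with hij | hij
    · exact smul_mem _ _ (hV hij (hu i))
    · rw [hMinv hij, zero_smul]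
      exact zero_mem _
  · have := FiniteDimensional.span_of_finite ℝ (Set.finite_range u)
    refine Submodule.eq_of_le_of_finrank_le ?_ ?_
    · rw [span_le]
      rintro _ ⟨j, rfl⟩
      exact sum_mem fun i _ => smul_mem _ _ (subset_span ⟨i, rfl⟩)
    · rw [finrank_span_eq_card hdual.linearIndependent]
      exact finrank_range_le_card u

/-- The subspace of those elements of `V j` that are orthogonal to the whole frame. For an adapted
frame, only the `f i` with `i ≤ j` impose a condition. -/
noncomputable def frameCompl (V : Fin k → Submodule ℝ E) (f : Fin k → E) (j : Fin k) :
    Submodule ℝ E :=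
  V j ⊓ (span ℝ (Set.range f))ᗮ

theorem mem_frameCompl {j : Fin k} {x : E} :
    x ∈ frameCompl V f j ↔ x ∈ V j ∧ ∀ i, inner ℝ (f i) x = 0 := by
  rw [frameCompl, mem_inf, mem_orthogonal]
  refine and_congr_right fun _ => ⟨fun hx i => hx _ (subset_span ⟨i, rfl⟩), fun hx u hu => ?_⟩
  induction hu using span_induction with
  | mem y hy => obtain ⟨i, rfl⟩ := hy; exact hx i
  | zero => simp
  | add a b _ _ ha hb => rw [inner_add_left, ha, hb, add_zero]
  | smul a y _ hy => rw [inner_smul_left, hy, mul_zero]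

theorem IsAdaptedFrame.finrank_frameCompl [FiniteDimensional ℝ E] (h : IsAdaptedFrame V f)
    (hV : Monotone V) (j : Fin k) :
    Module.finrank ℝ (frameCompl V f j) + (j + 1) = Module.finrank ℝ (V j) := by
  let g : Fin (j + 1) → E := fun i => f (Fin.castLE (by omega) i)
  have hg : LinearIndependent ℝ g :=
    h.isDualFamily_self.linearIndependent.comp _ (Fin.castLE_injective _)
  have hle : span ℝ (Set.range g) ≤ V j := by
    rw [span_le]
    rintro _ ⟨i, rfl⟩
    refine hV ?_ (h.mem _)
    rw [Fin.le_def]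
    exact Nat.lt_succ_iff.1 i.2
  have heq : frameCompl V f j = (span ℝ (Set.range g))ᗮ ⊓ V j := by
    ext x
    rw [mem_frameCompl, mem_inf, and_comm]
    refine and_congr_left fun hx => ⟨fun hxf => ?_, fun hxg i => ?_⟩
    · rw [mem_orthogonal]
      intro u hu
      obtain ⟨c, rfl⟩ := (mem_span_range_iff_exists_fun ℝ).1 hu
      simp [sum_inner, inner_smul_left, g, hxf]
    · rcases le_or_gt i j with hij | hij
      · exact (mem_orthogonal _ _).1 hxg _ (subset_span ⟨⟨i, by
          rw [Fin.le_def] at hij; omega⟩, rfl⟩)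
      · exact h.inner_eq_zero j i hij x hx
  rw [heq, ← finrank_add_inf_finrank_orthogonal hle, finrank_span_eq_card hg, Fintype.card_fin,
    add_comm]

theorem LinearIndependent.le_finrank_span_inf [FiniteDimensional ℝ E] {v : Fin k → E}
    (hv : LinearIndependent ℝ v) (hV : Monotone V) (hvV : ∀ j, v j ∈ V j) (j : Fin k) :
    (j : ℕ) + 1 ≤ Module.finrank ℝ ↥(span ℝ (Set.range v) ⊓ V j) := by
  let g : Fin (j + 1) → E := fun i => v (Fin.castLE (by omega) i)
  have hg : LinearIndependent ℝ g := hv.comp _ (Fin.castLE_injective _)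
  have hle : span ℝ (Set.range g) ≤ span ℝ (Set.range v) ⊓ V j := by
    rw [span_le]
    rintro _ ⟨i, rfl⟩
    refine ⟨subset_span ⟨_, rfl⟩, hV ?_ (hvV _)⟩
    rw [Fin.le_def]
    exact Nat.lt_succ_iff.1 i.2
  have := Submodule.finrank_mono hle
  rwa [finrank_span_eq_card hg, Fintype.card_fin] at this

end

/-! ### Recovering a dual family and a base point from projection coordinates -/

section
open Matrix Submodule MvPolynomial Topology

variable {n k : ℕ}

theorem flatCoord_congr {u v : Fin k → EuclideanSpace ℝ (Fin n)} (hu : LinearIndependent ℝ u)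
    (hv : LinearIndependent ℝ v) (huv : span ℝ (Set.range u) = span ℝ (Set.range v))
    {p q : EuclideanSpace ℝ (Fin n)} (hpq : p - q ∈ span ℝ (Set.range v)) :
    flatCoord u p = flatCoord v q := by
  have h : ∀ w, gramProj u w = gramProj v w := fun w => by
    rw [← starProjection_span_range_eq_gramProj hu, ← starProjection_span_range_eq_gramProj hv, huv]
  have hfoot : p - gramProj v p = q - gramProj v q := by
    have := starProjection_eq_self_iff.2 hpq
    rw [map_sub, starProjection_span_range_eq_gramProj hv,
      starProjection_span_range_eq_gramProj hv] at this
    rw [sub_eq_sub_iff_sub_eq_sub, this]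
  funext s
  rcases s with ⟨a, b⟩ | a
  · simp [flatCoord, h]
  · simp only [flatCoord, Sum.elim_inr, h, hfoot]

/-- The polynomial `⟪x, P y⟫` in the coordinates `[P, b]`. -/
noncomputable def projPoly (x y : EuclideanSpace ℝ (Fin n)) :
    MvPolynomial ((Fin n × Fin n) ⊕ Fin n) ℝ :=
  ∑ a, ∑ b, C (x a * y b) * X (Sum.inl (a, b))

/-- The polynomial `⟪x, b⟫` in the coordinates `[P, b]`. -/
noncomputable def footPoly (x : EuclideanSpace ℝ (Fin n)) :
    MvPolynomial ((Fin n × Fin n) ⊕ Fin n) ℝ :=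
  ∑ a, C (x a) * X (Sum.inr a)

theorem aeval_projPoly {v : Fin k → EuclideanSpace ℝ (Fin n)} (hv : LinearIndependent ℝ v)
    (p x y : EuclideanSpace ℝ (Fin n)) :
    aeval (flatCoord v p) (projPoly x y) = inner ℝ x (gramProj v y) := by
  have hy : gramProj v y = ∑ b, y b • gramProj v (EuclideanSpace.single b 1) := by
    simp_rw [← starProjection_span_range_eq_gramProj hv, ← map_smul, ← map_sum]
    congr 1
    ext a
    simp [Pi.single_apply]
  rw [hy]
  simp only [projPoly, map_sum, map_mul, aeval_C, aeval_X, flatCoord, Sum.elim_inl,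
    PiLp.inner_apply]
  refine Finset.sum_congr rfl fun a _ => ?_
  simp [mul_comm _ (x a), Finset.mul_sum, mul_assoc]

theorem aeval_footPoly (v : Fin k → EuclideanSpace ℝ (Fin n)) (p x : EuclideanSpace ℝ (Fin n)) :
    aeval (flatCoord v p) (footPoly x) = inner ℝ x (p - gramProj v p) := by
  simp [footPoly, flatCoord, PiLp.inner_apply, mul_comm]

/-- The matrix with `(l, j)` entry `⟪f j, P (f l)⟫`. If `v` is a basis of the range of `P` dual to
`f`, then its `l`-th row consists of the coefficients of `P (f l)` in the basis `v`. -/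
noncomputable def framePoly (f : Fin k → EuclideanSpace ℝ (Fin n)) :
    Matrix (Fin k) (Fin k) (MvPolynomial ((Fin n × Fin n) ⊕ Fin n) ℝ) :=
  of fun l j => projPoly (f j) (f l)

/-- The numerator of `⟪x, v j⟫` as a rational function of `[P, b]` with denominator
`det (framePoly f)`, where `v` is the basis of the range of `P` dual to `f`: Cramer's rule for the
system `⟪x, P (f l)⟫ = ∑ j, ⟪f j, P (f l)⟫ * ⟪x, v j⟫`. -/
noncomputable def vecPoly (f : Fin k → EuclideanSpace ℝ (Fin n)) (x : EuclideanSpace ℝ (Fin n))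
    (j : Fin k) : MvPolynomial ((Fin n × Fin n) ⊕ Fin n) ℝ :=
  ((framePoly f).adjugate *ᵥ fun l => projPoly x (f l)) j

variable {f v : Fin k → EuclideanSpace ℝ (Fin n)}

theorem gramProj_mem_span (v : Fin k → EuclideanSpace ℝ (Fin n)) (w : EuclideanSpace ℝ (Fin n)) :
    gramProj v w ∈ span ℝ (Set.range v) :=
  sum_mem fun i _ => sum_mem fun _ _ => smul_mem _ _ (subset_span (Set.mem_range_self i))

/-- A combination `w` of the frame that is killed by the matrix has `P w = 0`, so it is orthogonal to
the dual family and vanishes. -/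
theorem aeval_det_framePoly_ne_zero (h : IsDualFamily f v) (p : EuclideanSpace ℝ (Fin n)) :
    aeval (flatCoord v p) (framePoly f).det ≠ 0 := by
  have hv := h.linearIndependent
  rw [AlgHom.map_det]
  intro h0
  obtain ⟨y, hy0, hy⟩ := exists_vecMul_eq_zero_iff.2 h0
  set w := ∑ l, y l • f l with hw
  have hPw : ∀ j, inner ℝ (f j) (gramProj v w) = 0 := by
    intro j
    have := congr_fun hy j
    simp only [vecMul, dotProduct, AlgHom.mapMatrix_apply, map_apply, framePoly, of_apply,
      aeval_projPoly hv, Pi.zero_apply] at this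
    rw [← this, hw]
    simp_rw [← starProjection_span_range_eq_gramProj hv, map_sum, map_smul, inner_sum,
      inner_smul_right]
  have hP0 : gramProj v w = 0 := by
    rw [h.eq_sum_smul (gramProj_mem_span v w)]
    simp [hPw]
  refine hy0 (funext fun j => ?_)
  have hwv : w ∈ (span ℝ (Set.range v))ᗮ := by
    rw [← starProjection_apply_eq_zero_iff, starProjection_span_range_eq_gramProj hv, hP0]
  have := inner_left_of_mem_orthogonal (subset_span (Set.mem_range_self j)) hwv
  simpa [hw, sum_inner, inner_smul_left, h _ j] using this

theorem aeval_vecPoly (h : IsDualFamily f v) (p x : EuclideanSpace ℝ (Fin n)) (j : Fin k) :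
    aeval (flatCoord v p) (vecPoly f x j) =
      inner ℝ x (v j) * aeval (flatCoord v p) (framePoly f).det := by
  have hv := h.linearIndependent
  set F := aeval (R := ℝ) (flatCoord v p) with hF
  set Q := (framePoly f).map F with hQ
  have hvec : (fun l => F (projPoly x (f l))) = Q *ᵥ fun j => inner ℝ x (v j) := by
    funext l
    rw [hF, aeval_projPoly hv, h.eq_sum_smul (gramProj_mem_span v (f l)), inner_sum]
    simp only [mulVec, dotProduct, hQ, map_apply, framePoly, of_apply, hF, aeval_projPoly hv,
      inner_smul_right]
  have hadj : F (vecPoly f x j) = (Q.adjugate *ᵥ fun l => F (projPoly x (f l))) j := by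
    have : Q.adjugate = (framePoly f).adjugate.map F := (AlgHom.map_adjugate F _).symm
    simp [vecPoly, mulVec, dotProduct, this]
  rw [hadj, hvec, mulVec_mulVec, adjugate_mul, smul_mulVec, one_mulVec, AlgHom.map_det, mul_comm]
  rfl

/-- The numerator of `⟪x, s⟫` as a rational function of `[P, b]` with denominator
`det (framePoly f)`, where `o + s` is the point of the flat with `s` orthogonal to the frame:
`s = (b - o) - ∑ j, ⟪f j, b - o⟫ • v j`. -/
noncomputable def shiftPoly (f : Fin k → EuclideanSpace ℝ (Fin n))
    (o x : EuclideanSpace ℝ (Fin n)) : MvPolynomial ((Fin n × Fin n) ⊕ Fin n) ℝ :=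
  (footPoly x - C (inner ℝ x o)) * (framePoly f).det -
    ∑ j, (footPoly (f j) - C (inner ℝ (f j) o)) * vecPoly f x j

theorem aeval_shiftPoly (h : IsDualFamily f v) (o x : EuclideanSpace ℝ (Fin n))
    {s : EuclideanSpace ℝ (Fin n)} (hs : ∀ j, inner ℝ (f j) s = 0) :
    aeval (flatCoord v (o + s)) (shiftPoly f o x) =
      inner ℝ x s * aeval (flatCoord v (o + s)) (framePoly f).det := by
  have hP := h.eq_sum_smul (gramProj_mem_span v (o + s))
  have hc : ∀ j, inner ℝ (f j) (o + s - gramProj v (o + s)) - inner ℝ (f j) o =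
      -inner ℝ (f j) (gramProj v (o + s)) := fun j => by
    rw [inner_sub_right, inner_add_right, hs]; ring
  have hx : inner ℝ x (gramProj v (o + s)) =
      ∑ j, inner ℝ (f j) (gramProj v (o + s)) * inner ℝ x (v j) := by
    conv_lhs => rw [hP]
    simp [inner_sum, inner_smul_right]
  simp only [shiftPoly, map_sub, map_mul, map_sum, aeval_footPoly, aeval_C, aeval_vecPoly h,
    Algebra.algebraMap_self, RingHom.id_apply, hc]
  simp only [neg_mul, Finset.sum_neg_distrib, ← mul_assoc, ← Finset.sum_mul, ← hx]
  rw [inner_sub_right, inner_add_right]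
  ring

end

/-! ### A slice of normalized flats, dense in the Schubert variety -/

section
open Matrix Submodule MvPolynomial Topology

variable {n k : ℕ}

/-- The index type of the slice parameters: coordinates on `frameCompl V f j` for every `j`, for the
direction, and on `frameCompl V f j₀`, for the base point. -/
abbrev SliceIndex (V : Fin k → Submodule ℝ (EuclideanSpace ℝ (Fin n)))
    (f : Fin k → EuclideanSpace ℝ (Fin n)) (j₀ : Fin k) : Type :=
  (Σ j, Fin (Module.finrank ℝ (frameCompl V f j))) ⊕ Fin (Module.finrank ℝ (frameCompl V f j₀))

variable (V : Fin k → Submodule ℝ (EuclideanSpace ℝ (Fin n)))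
  (f : Fin k → EuclideanSpace ℝ (Fin n)) (j₀ : Fin k) (o : EuclideanSpace ℝ (Fin n))

/-- An orthonormal basis of `frameCompl V f j`, as vectors of the ambient space. -/
noncomputable def complBasis (j : Fin k) (i : Fin (Module.finrank ℝ (frameCompl V f j))) :
    EuclideanSpace ℝ (Fin n) :=
  stdOrthonormalBasis ℝ (frameCompl V f j) i

/-- The spanning vectors of the direction of the slice flat with parameter `t`: the general family
dual to the frame, with `j`-th member in `V j`. -/
noncomputable def sliceVec (t : SliceIndex V f j₀ → ℝ) (j : Fin k) : EuclideanSpace ℝ (Fin n) :=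
  f j + ∑ i, t (Sum.inl ⟨j, i⟩) • complBasis V f j i

/-- The displacement from the origin `o` of the base point of the slice flat with parameter `t`. -/
noncomputable def sliceShift (t : SliceIndex V f j₀ → ℝ) : EuclideanSpace ℝ (Fin n) :=
  ∑ i, t (Sum.inr i) • complBasis V f j₀ i

variable {V f j₀ o}

theorem complBasis_mem (j : Fin k) (i) : complBasis V f j i ∈ frameCompl V f j :=
  Subtype.property _

theorem inner_complBasis (j : Fin k) (i i') :
    inner ℝ (complBasis V f j i) (complBasis V f j i') = if i = i' then (1 : ℝ) else 0 :=
  orthonormal_iff_ite.1 (stdOrthonormalBasis ℝ (frameCompl V f j)).orthonormal i i'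

theorem exists_eq_sum_complBasis {j : Fin k} {x : EuclideanSpace ℝ (Fin n)}
    (hx : x ∈ frameCompl V f j) : ∃ c : _ → ℝ, x = ∑ i, c i • complBasis V f j i := by
  refine ⟨(stdOrthonormalBasis ℝ (frameCompl V f j)).repr ⟨x, hx⟩, ?_⟩
  have := congr_arg Subtype.val ((stdOrthonormalBasis ℝ (frameCompl V f j)).sum_repr ⟨x, hx⟩)
  simpa [complBasis] using this.symm

theorem sliceShift_mem (t : SliceIndex V f j₀ → ℝ) : sliceShift V f j₀ t ∈ frameCompl V f j₀ :=
  sum_mem fun i _ => smul_mem _ _ (complBasis_mem j₀ i)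

theorem sliceVec_mem (h : IsAdaptedFrame V f) (t : SliceIndex V f j₀ → ℝ) (j : Fin k) :
    sliceVec V f j₀ t j ∈ V j :=
  add_mem (h.mem j) (sum_mem fun i _ => smul_mem _ _ (complBasis_mem j i).1)

theorem isDualFamily_sliceVec (h : IsAdaptedFrame V f) (t : SliceIndex V f j₀ → ℝ) :
    IsDualFamily f (sliceVec V f j₀ t) := by
  intro i j
  have : ∀ l, inner ℝ (f i) (complBasis V f j l) = 0 := fun l =>
    (mem_frameCompl.1 (complBasis_mem j l)).2 i
  rw [sliceVec, inner_add_right, h.isDualFamily_self i j]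
  simp [inner_sum, inner_smul_right, this]

theorem exists_sliceVec_sliceShift_eq (h : IsAdaptedFrame V f)
    {v : Fin k → EuclideanSpace ℝ (Fin n)} (hv : ∀ j, v j ∈ V j) (hdual : IsDualFamily f v)
    {s : EuclideanSpace ℝ (Fin n)} (hs : s ∈ frameCompl V f j₀) :
    ∃ t : SliceIndex V f j₀ → ℝ, sliceVec V f j₀ t = v ∧ sliceShift V f j₀ t = s := by
  have hmem : ∀ j, v j - f j ∈ frameCompl V f j := fun j =>
    mem_frameCompl.2 ⟨sub_mem (hv j) (h.mem j), fun i => by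
      rw [inner_sub_right, hdual, h.isDualFamily_self, sub_self]⟩
  choose c hc using fun j => exists_eq_sum_complBasis (hmem j)
  obtain ⟨d, hd⟩ := exists_eq_sum_complBasis hs
  refine ⟨Sum.elim (fun q => c q.1 q.2) d, ?_, ?_⟩
  · funext j
    simp [sliceVec, ← hc]
  · simp [sliceShift, ← hd]

theorem inner_complBasis_sliceVec (t : SliceIndex V f j₀ → ℝ) (j : Fin k) (i) :
    inner ℝ (complBasis V f j i) (sliceVec V f j₀ t j) = t (Sum.inl ⟨j, i⟩) := by
  have : inner ℝ (complBasis V f j i) (f j) = 0 := by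
    rw [real_inner_comm]
    exact (mem_frameCompl.1 (complBasis_mem j i)).2 j
  simp [sliceVec, inner_add_right, this, inner_sum, inner_smul_right, inner_complBasis]

theorem inner_complBasis_sliceShift (t : SliceIndex V f j₀ → ℝ) (i) :
    inner ℝ (complBasis V f j₀ i) (sliceShift V f j₀ t) = t (Sum.inr i) := by
  simp [sliceShift, inner_sum, inner_smul_right, inner_complBasis]

theorem sliceVec_mem_regularFunctions (j : Fin k) (a : Fin n) :
    (fun t => sliceVec V f j₀ t j a) ∈ regularFunctions (SliceIndex V f j₀) := by
  have : (fun t => sliceVec V f j₀ t j a) = (fun _ => f j a) +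
      ∑ i, (fun t : SliceIndex V f j₀ → ℝ => t (Sum.inl ⟨j, i⟩)) *
        fun _ => complBasis V f j i a := by
    funext t
    simp [sliceVec]
  rw [this]
  exact add_mem (const_mem_regularFunctions _) (sum_mem fun i _ =>
    mul_mem (coord_mem_regularFunctions _) (const_mem_regularFunctions _))

theorem sliceShift_mem_regularFunctions (a : Fin n) :
    (fun t => sliceShift V f j₀ t a) ∈ regularFunctions (SliceIndex V f j₀) := by
  have : (fun t => sliceShift V f j₀ t a) =
      ∑ i, (fun t : SliceIndex V f j₀ → ℝ => t (Sum.inr i)) *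
        fun _ => complBasis V f j₀ i a := by
    funext t
    simp [sliceShift]
  rw [this]
  exact sum_mem fun i _ =>
    mul_mem (coord_mem_regularFunctions _) (const_mem_regularFunctions _)

variable (V f j₀ o) in
/-- The projection coordinates of the slice flat with parameter `t`. -/
noncomputable def sliceCoord (t : SliceIndex V f j₀ → ℝ) : (Fin n × Fin n) ⊕ Fin n → ℝ :=
  flatCoord (sliceVec V f j₀ t) (o + sliceShift V f j₀ t)

theorem realVarietyDim_range_sliceCoord (h : IsAdaptedFrame V f) :
    realVarietyDim (Set.range (sliceCoord V f j₀ o)) =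
      ((Fintype.card (SliceIndex V f j₀) : ℕ∞) : WithBot ℕ∞) := by
  have hli : ∀ t, LinearIndependent ℝ (sliceVec V f j₀ t) := fun t =>
    (isDualFamily_sliceVec h t).linearIndependent
  have hpt : ∀ a, (fun t => (o + sliceShift V f j₀ t) a) ∈ regularFunctions _ := fun a =>
    add_mem (const_mem_regularFunctions (o a)) (sliceShift_mem_regularFunctions a)
  apply realVarietyDim_range
  · rintro (⟨a, b⟩ | a)
    · exact gramProj_mem_regularFunctions hli sliceVec_mem_regularFunctions
        (fun c => const_mem_regularFunctions _) a
    · exact sub_mem (hpt a)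
        (gramProj_mem_regularFunctions hli sliceVec_mem_regularFunctions hpt a)
  · rintro (⟨j, i⟩ | i)
    · refine ⟨vecPoly f (complBasis V f j i) j, (framePoly f).det, fun t =>
        ⟨aeval_det_framePoly_ne_zero (isDualFamily_sliceVec h t) _, ?_⟩⟩
      rw [sliceCoord, aeval_vecPoly (isDualFamily_sliceVec h t), inner_complBasis_sliceVec]
    · refine ⟨shiftPoly f o (complBasis V f j₀ i), (framePoly f).det, fun t =>
        ⟨aeval_det_framePoly_ne_zero (isDualFamily_sliceVec h t) _, ?_⟩⟩
      rw [sliceCoord, aeval_shiftPoly (isDualFamily_sliceVec h t) _ _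
        (mem_frameCompl.1 (sliceShift_mem t)).2, inner_complBasis_sliceShift]

theorem sum_fin_add_one (k : ℕ) :
    ∑ j : Fin k, (((j : ℕ) + 1 : ℕ) : ℚ) = (k : ℚ) * (k + 1) / 2 := by
  induction k with
  | zero => simp
  | succ k ih =>
    rw [Fin.sum_univ_castSucc]
    simp only [Fin.val_castSucc, ih, Fin.val_last]
    push_cast
    ring

theorem card_sliceIndex (h : IsAdaptedFrame V f) (hV : Monotone V) (hj₀ : (j₀ : ℕ) = 0) :
    (Fintype.card (SliceIndex V f j₀) : ℚ) = (∑ j, (Module.finrank ℝ (V j) : ℚ)) -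
      (k : ℚ) * (k + 1) / 2 + (Module.finrank ℝ (V j₀) - 1) := by
  have hw : ∀ j, (Module.finrank ℝ (frameCompl V f j) : ℚ) =
      Module.finrank ℝ (V j) - ((j : ℕ) + 1 : ℕ) := fun j => by
    rw [← h.finrank_frameCompl hV j]
    push_cast
    ring
  simp only [Fintype.card_sum, Fintype.card_sigma, Fintype.card_fin, Nat.cast_add, Nat.cast_sum,
    hw, Finset.sum_sub_distrib]
  rw [← sum_fin_add_one, hj₀]
  simp

/-- A flat `p + span u` with `p - o ∈ V j₀` and `u j ∈ V j` belongs to the slice if it satisfies the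
genericity condition `⟪f j, u j⟫ ≠ 0` for all `j`. -/
theorem flatCoord_mem_range_sliceCoord (h : IsAdaptedFrame V f) (hV : Monotone V)
    {u : Fin k → EuclideanSpace ℝ (Fin n)} (hu : ∀ j, u j ∈ V j)
    (hne : ∀ j, inner ℝ (f j) (u j) ≠ 0) {p : EuclideanSpace ℝ (Fin n)}
    (hp : p - o ∈ V j₀) (hj₀ : ∀ j, j₀ ≤ j) :
    flatCoord u p ∈ Set.range (sliceCoord V f j₀ o) := by
  obtain ⟨v, hv, hdual, hspan⟩ := h.exists_isDualFamily hV hu hne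
  have hvli := hdual.linearIndependent
  have huli : LinearIndependent ℝ u := by
    rw [linearIndependent_iff_card_eq_finrank_span, Set.finrank, ← hspan,
      finrank_span_eq_card hvli]
  -- move `p` inside the flat to make its displacement from `o` orthogonal to `f j₀`
  set s := (p - o) - inner ℝ (f j₀) (p - o) • v j₀ with hs
  have hsW : s ∈ frameCompl V f j₀ := by
    refine mem_frameCompl.2 ⟨sub_mem hp (smul_mem _ _ (hv j₀)), fun i => ?_⟩
    rw [hs, inner_sub_right, inner_smul_right, hdual]
    rcases eq_or_ne i j₀ with rfl | hi
    · simp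
    · rw [h.inner_eq_zero j₀ i (lt_of_le_of_ne (hj₀ i) hi.symm) _ hp, if_neg hi]
      ring
  obtain ⟨t, htv, hts⟩ := exists_sliceVec_sliceShift_eq h hv hdual hsW
  refine ⟨t, ?_⟩
  rw [sliceCoord, htv, hts]
  refine (flatCoord_congr huli hvli hspan.symm ?_).symm
  have : p - (o + s) = inner ℝ (f j₀) (p - o) • v j₀ := by rw [hs]; abel
  rw [this]
  exact smul_mem _ _ (subset_span (Set.mem_range_self j₀))

/-- A polynomial vanishing on the slice vanishes at `p + span u` even when `u` is not generic: the
vectors `u j + ε • f j` are generic for small `ε ≠ 0`, and the coordinates depend continuously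
on `ε`. -/
theorem aeval_flatCoord_eq_zero (h : IsAdaptedFrame V f) (hV : Monotone V)
    {u : Fin k → EuclideanSpace ℝ (Fin n)} (huli : LinearIndependent ℝ u) (hu : ∀ j, u j ∈ V j)
    {p : EuclideanSpace ℝ (Fin n)} (hp : p - o ∈ V j₀) (hj₀ : ∀ j, j₀ ≤ j)
    {g : MvPolynomial ((Fin n × Fin n) ⊕ Fin n) ℝ}
    (hg : g ∈ vanishingIdeal ℝ (Set.range (sliceCoord V f j₀ o))) :
    aeval (flatCoord u p) g = 0 := by
  set U : ℝ → Fin k → EuclideanSpace ℝ (Fin n) := fun ε j => u j + ε • f j with hU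
  have hU0 : U 0 = u := by simp [hU]
  have hUc : Continuous U := by fun_prop
  have hproj : ∀ w, Filter.Tendsto (fun ε => gramProj (U ε) w) (𝓝 0) (𝓝 (gramProj u w)) :=
    fun w => by
      have := continuousAt_gramProj hUc (t := 0) (by rwa [hU0]) w
      rwa [ContinuousAt, hU0] at this
  have hcoord : ∀ a, Continuous fun x : EuclideanSpace ℝ (Fin n) => x a := fun a => by fun_prop
  have hflat : Filter.Tendsto (fun ε => flatCoord (U ε) p) (𝓝 0) (𝓝 (flatCoord u p)) := by
    rw [tendsto_pi_nhds]
    rintro (⟨a, b⟩ | a)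
    · exact ((hcoord a).tendsto _).comp (hproj _)
    · exact ((hcoord a).tendsto _).comp (tendsto_const_nhds.sub (hproj p))
  have hlim : Filter.Tendsto (fun ε => aeval (flatCoord (U ε) p) g) (𝓝[≠] 0)
      (𝓝 (aeval (flatCoord u p) g)) :=
    ((MvPolynomial.continuous_eval g).tendsto _).comp (hflat.mono_left nhdsWithin_le_nhds)
  have hne : ∀ᶠ ε in 𝓝[≠] (0 : ℝ), ∀ j, inner ℝ (f j) (U ε j) ≠ 0 := by
    rw [Filter.eventually_all]
    intro j
    have : ∀ ε, inner ℝ (f j) (U ε j) = ε - -inner ℝ (f j) (u j) := fun ε => by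
      simp only [hU, inner_add_right, inner_smul_right, h.inner_self]
      ring
    simp only [this, sub_ne_zero]
    rcases eq_or_ne (-inner ℝ (f j) (u j)) 0 with h0 | h0
    · rw [h0]
      exact eventually_mem_nhdsWithin
    · exact (eventually_ne_nhds h0.symm).filter_mono nhdsWithin_le_nhds
  refine tendsto_nhds_unique hlim (tendsto_const_nhds.congr' ?_)
  filter_upwards [hne] with ε hε
  exact (hg _ (flatCoord_mem_range_sliceCoord h hV
    (fun j => add_mem (hu j) (smul_mem _ _ (h.mem j))) hε hp hj₀)).symm

/-- The slice is contained in the affine Schubert variety and Zariski dense in it. -/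
theorem vanishingIdeal_affineSchubert {A : Fin k → AffineSubspace ℝ (EuclideanSpace ℝ (Fin n))}
    (hA : Monotone A) (h : IsAdaptedFrame (fun j => (A j).direction) f) (hk : 0 < k)
    (ho : o ∈ A ⟨0, hk⟩) :
    vanishingIdeal ℝ (Graff.projCoord '' affineSchubert A) =
      vanishingIdeal ℝ (Set.range (sliceCoord (fun j => (A j).direction) f ⟨0, hk⟩ o)) := by
  have hV : Monotone fun j => (A j).direction := fun i j hij => AffineSubspace.direction_le (hA hij)
  have hj₀ : ∀ j : Fin k, ⟨0, hk⟩ ≤ j := fun j => Nat.zero_le _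
  apply le_antisymm
  · refine vanishingIdeal_anti_mono ?_
    rintro _ ⟨t, rfl⟩
    have hli := (isDualFamily_sliceVec h t).linearIndependent
    refine ⟨Graff.ofSpan _ _ hli, ?_, Graff.projCoord_ofSpan _ hli⟩
    refine (mem_affineSchubert_iff_finrank hA hk).2 ⟨_, Graff.mem_ofSpan _ hli, ?_, fun j => ?_⟩
    · rw [add_comm]
      exact AffineSubspace.vadd_mem_of_mem_direction (mem_frameCompl.1 (sliceShift_mem t)).1 ho
    · rw [Graff.direction_ofSpan]
      exact hli.le_finrank_span_inf hV (sliceVec_mem h t) j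
  · rintro g hg _ ⟨B, hB, rfl⟩
    obtain ⟨p, hpB, hpA, hfin⟩ := (mem_affineSchubert_iff_finrank hA hk).1 hB
    obtain ⟨u, huli, hu⟩ := exists_linearIndependent_mem hfin
    have hdim : Module.finrank ℝ B.1.direction = k := by
      have := affineDim_eq_finrank_direction hpB
      rw [B.2] at this
      exact_mod_cast this.symm
    have hspan : B.1.direction = span ℝ (Set.range u) := by
      refine (Submodule.eq_of_le_of_finrank_le ?_ ?_).symm
      · rw [span_le]
        rintro _ ⟨j, rfl⟩
        exact (hu j).1
      · rw [hdim, finrank_span_eq_card huli, Fintype.card_fin]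
    rw [Graff.projCoord_eq_flatCoord B huli hspan hpB]
    exact aeval_flatCoord_eq_zero h hV huli (fun j => (hu j).2)
      (AffineSubspace.vsub_mem_direction hpA ho) hj₀ hg

end

theorem theorem6p2 (k n : ℕ) (hk : 1 ≤ k)
    (A : Fin k → AffineSubspace ℝ (EuclideanSpace ℝ (Fin n))) (hA : StrictMono A)
    (d : Fin k → ℕ) (hd : ∀ j, affineDim (A j) = (d j : WithBot ℕ))
    (hd1 : 1 ≤ d ⟨0, hk⟩) :
    ∃ m : ℕ, Graff.varietyDim (affineSchubert A) = ((m : ℕ∞) : WithBot ℕ∞) ∧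
      (m : ℚ) = (∑ j, (d j : ℚ)) - (k : ℚ) * ((k : ℚ) + 1) / 2 + ((d ⟨0, hk⟩ : ℚ) - 1) := by
  have hne : ∀ j, (A j : Set (EuclideanSpace ℝ (Fin n))).Nonempty := fun j => by
    rw [AffineSubspace.nonempty_iff_ne_bot]
    intro h
    have := hd j
    rw [h] at this
    simp [affineDim] at this
  have hdim : ∀ j, Module.finrank ℝ (A j).direction = d j := fun j => by
    obtain ⟨q, hq⟩ := hne j
    have := hd j
    rw [affineDim_eq_finrank_direction hq] at this
    exact_mod_cast this
  have hV : StrictMono fun j => (A j).direction := fun i j hij =>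
    AffineSubspace.direction_lt_of_nonempty (hA hij) (hne i)
  obtain ⟨f, hf⟩ := exists_isAdaptedFrame hV fun j hj => by
    have h0 : (A ⟨0, hk⟩).direction ≤ (A j).direction :=
      hV.monotone (show (⟨0, hk⟩ : Fin k) ≤ j from Nat.zero_le _)
    rw [hj, le_bot_iff] at h0
    have := hdim ⟨0, hk⟩
    rw [h0, finrank_bot] at this
    omega
  obtain ⟨o, ho⟩ := hne ⟨0, hk⟩
  refine ⟨Fintype.card (SliceIndex (fun j => (A j).direction) f ⟨0, hk⟩), ?_, ?_⟩
  · rw [Graff.varietyDim, realVarietyDim, vanishingIdeal_affineSchubert hA.monotone hf hk ho]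
    exact realVarietyDim_range_sliceCoord hf
  · rw [card_sliceIndex hf hV.monotone rfl]
    simp only [hdim]
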